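/- Let $K$ be a number field which is Galois over $\mathbb{Q}$, of odd degree, and either totally real or CM. Let $\mathcal{O}_K$ be its ring of integers and $\mathcal{D}_K$ its different over $\mathbb{Q}$, and let $x\mapsto\bar x$ denote complex conjugation on $K$ if $K$ is CM and the identity if $K$ is totally real. An ideal lattice over $K$ is a pair $(I,\alpha)$ consisting of a nonzero fractional $\mathcal{O}_K$-ideal $I$ and a totally positive $\alpha\in K^\times$, where $I$ carries the positive definite symmetric bilinear form $b_\alpha(x,y)=\mathrm{Tr}_{K/\mathbb{Q}}(\alpha x\bar y)$; its dual is $I^*=\{x\in K: b_\alpha(x,y)\in\mathbb{Z}\ \text{for all } y\in I\}$. For a positive integer $\ell$, the lattice $(I,\alpha)$ is Arakelov-modular of level $\ell$ if there is $\beta\in K^\times$ with $I=\beta I^*$ and $\ell=\beta\bar\beta$; it is unimodular if $b_\alpha$ is integer-valued on $I$ and $I=I^*$. Let $\mathrm{Mod}(K)$ be the set of square-free positive integers $\ell$ for which there exists an Arakelov-modular lattice of level $\ell$ over $K$. Then: 1. $\mathrm{Mod}(K)=\{1\}$; that is, an Arakelov-modular lattice of level $1$ exists over $K$, and $1$ is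 the only square-free level at which one exists. 2. For every nonzero prime ideal $\mathfrak{P}$ of $\mathcal{O}_K$, the exponent $v_{\mathfrak{P}}(\mathcal{D}_K)$ of $\mathfrak{P}$ in the factorization of $\mathcal{D}_K$ is even. 3. There is a unique fractional ideal $\mathcal{D}_K^{-1/2}$ of $K$ whose square is $\mathcal{D}_K^{-1}$, and $(\mathcal{D}_K^{-1/2},1)$ is an Arakelov-modular lattice of level $1$; in particular, it is a unimodular lattice. -/

import Mathlib

open NumberField nonZeroDivisors

noncomputable section

namespace ArakelovLattice

variable (K : Type*) [Field K] [NumberField K]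

open Classical in
/-- The conjugation `x ↦ x̄` of a number field `K` that is totally real or CM: complex conjugation
if `K` is CM, and the identity if `K` is totally real. (For other fields the value is
irrelevant.) -/
def conj : K ≃ₐ[ℚ] K :=
  if h : IsCMField K then
    haveI := h
    (IsCMField.complexConj K).restrictScalars ℚ
  else AlgEquiv.refl

variable {K}

/-- `α` is totally positive: `σ(α)` is a positive real number for every embedding `σ : K → ℂ`. -/
def IsTotallyPositive (α : K) : Prop :=
  ∀ σ : K →+* ℂ, (σ α).im = 0 ∧ 0 < (σ α).re

/-- The form `b_α(x, y) = Tr_{K/ℚ}(α x ȳ)`, on all of `K`. -/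
def form (α : K) : LinearMap.BilinForm ℚ K :=
  (Algebra.traceForm ℚ K).compl₁₂ (LinearMap.mulLeft ℚ α) (conj K).toLinearMap

theorem form_apply (α x y : K) : form α x y = Algebra.trace ℚ K (α * x * conj K y) := rfl

/-- A fractional ideal of `K`, regarded as a subgroup of `K`. -/
def lattice (I : FractionalIdeal (𝓞 K)⁰ K) : Submodule ℤ K :=
  (I : Submodule (𝓞 K) K).restrictScalars ℤ

/-- The dual lattice `I^* = {x ∈ K : b_α(x, y) ∈ ℤ for all y ∈ I}` of `(I, b_α)`. -/
def dualLattice (I : FractionalIdeal (𝓞 K)⁰ K) (α : K) : Submodule ℤ K :=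
  (form α).dualSubmodule (lattice I)

theorem mem_dualLattice (I : FractionalIdeal (𝓞 K)⁰ K) (α x : K) :
    x ∈ dualLattice I α ↔
      ∀ y ∈ I, ∃ m : ℤ, (m : ℚ) = Algebra.trace ℚ K (α * x * conj K y) := by
  simp only [dualLattice, LinearMap.BilinForm.mem_dualSubmodule, Submodule.mem_one]
  rfl

/-- `(I, b_α)` is an ideal lattice over `K`: `I` is a (nonzero) fractional ideal, `α` is totally
positive, and `b_α` is symmetric and positive definite on `I`. -/
structure IsIdealLattice (I : FractionalIdeal (𝓞 K)⁰ K) (α : K) : Prop where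
  ne_zero : I ≠ 0
  totallyPositive : IsTotallyPositive α
  symm : ∀ x ∈ I, ∀ y ∈ I, form α x y = form α y x
  posDef : ∀ x ∈ I, x ≠ 0 → 0 < form α x x

/-- `(I, b_α)` is an Arakelov-modular ideal lattice of level `ℓ`: there is `β ∈ K^×` with
`I = β I^*` and `ℓ = β β̄`. -/
def IsArakelovModular (I : FractionalIdeal (𝓞 K)⁰ K) (α : K) (ℓ : ℕ) : Prop :=
  IsIdealLattice I α ∧ ∃ β : K, β ≠ 0 ∧
    lattice I = (dualLattice I α).map (LinearMap.mulLeft ℤ β) ∧ (ℓ : K) = β * conj K β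

/-- `(I, b_α)` is a unimodular lattice: an ideal lattice that is integral (`b_α` takes integral
values on `I`) and equal to its dual lattice. -/
def IsUnimodular (I : FractionalIdeal (𝓞 K)⁰ K) (α : K) : Prop :=
  IsIdealLattice I α ∧ (∀ x ∈ I, ∀ y ∈ I, ∃ m : ℤ, (m : ℚ) = form α x y) ∧
    lattice I = dualLattice I α

variable (K)

/-- `Mod(K)`: the square-free positive integers `ℓ` such that there exists an Arakelov-modular
lattice of level `ℓ` over `K`. -/
def Mod : Set ℕ :=
  {ℓ | 0 < ℓ ∧ Squarefree ℓ ∧ ∃ (I : FractionalIdeal (𝓞 K)⁰ K) (α : K), IsArakelovModular I α ℓ}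

/-- The different `𝒟_K` of `K/ℚ`, as a fractional ideal. -/
def different : FractionalIdeal (𝓞 K)⁰ K :=
  (differentIdeal ℤ (𝓞 K) : FractionalIdeal (𝓞 K)⁰ K)

end ArakelovLattice

end

/-!
A CM field has even degree, so `K` is totally real and the conjugation is trivial. Two facts then
carry the theorem.

The first concerns levels: if `ℓ = β²` with `β ∈ K`, then `N(β)² = ℓ ^ [K : ℚ]` with an odd
exponent, so `ℓ` is a square, and a squarefree square is `1`
(`isSquare_of_natCast_eq_mul_self`).

The second is that the different has even exponent at every prime `P`
(`even_multiplicity_differentIdeal`). Let `E` be the inertia field of `P`. The prime of `E` below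
`P` is unramified over `ℤ`, so by transitivity only the different of `K / E` matters, and `P` is
totally ramified over `E` with trivial residue extension. By Nakayama's lemma a uniformizer `π` at
`P` generates `𝓞 K` over `𝓞 E` up to denominators prime to `P`, so the exponent of the different
is that of `∏_{g ≠ 1} (π - g π)`, the product being over the inertia group. The elements `g` and
`g⁻¹` contribute equally, because `π - g⁻¹ π = -g⁻¹ (π - g π)` and `g` fixes `P`. In a group of
odd order, inversion has no fixed point besides `1`, so the total exponent is even
(`even_multiplicity_differentIdeal_of_totallyRamified`).

Hence `𝒟⁻¹` has a square root `J`, unique because exponents are. The dual of `J` for the trace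
form is `𝒟⁻¹ J⁻¹ = J`, and `Tr(x²)` is a sum of real squares, so `J` is unimodular and
Arakelov-modular of level `1` with `β = 1`.
-/

namespace ArakelovLattice

open Polynomial

/-! ### Sums over a group of odd order -/

section Parity

/-- A function on a finite group of odd order that is invariant under inversion has even sum over
the nonidentity elements: inversion pairs them off without fixed points. -/
theorem even_sum_erase_one_of_inv_invariant {G : Type*} [Group G] [Fintype G] [DecidableEq G]
    (hG : Odd (Nat.card G)) (h : G → ℕ) (hinv : ∀ g, h g⁻¹ = h g) :
    Even (∑ g ∈ Finset.univ.erase 1, h g) := by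
  rw [← ZMod.natCast_eq_zero_iff_even, Nat.cast_sum]
  refine Finset.sum_involution (fun g _ ↦ g⁻¹) (fun g _ ↦ ?_) (fun g hg _ hfix ↦ ?_)
    (fun g hg ↦ by simpa using hg) (fun g _ ↦ inv_inv g)
  · rw [hinv]
    exact CharTwo.add_self_eq_zero _
  · have h2 : g ^ 2 = 1 := by
      rw [pow_two]
      nth_rewrite 1 [← hfix]
      exact inv_mul_cancel g
    have hd := Nat.eq_one_of_dvd_coprimes (Nat.coprime_two_left.mpr hG)
      (orderOf_dvd_of_pow_eq_one h2) (orderOf_dvd_natCard g)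
    exact (Finset.ne_of_mem_erase hg) (orderOf_eq_one_iff.mp hd)

end Parity

/-! ### Multiplicities of a prime in principal ideals -/

section Multiplicity

variable {B : Type*} [CommRing B] [IsDedekindDomain B]

theorem emultiplicity_span_singleton_eq_of_forall_mem_iff {P : Ideal B} {x y : B}
    (h : ∀ n : ℕ, x ∈ P ^ n ↔ y ∈ P ^ n) :
    emultiplicity P (Ideal.span {x}) = emultiplicity P (Ideal.span {y}) := by
  rw [emultiplicity_eq_emultiplicity_iff]
  intro n
  rw [Ideal.dvd_span_singleton, Ideal.dvd_span_singleton, h n]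

theorem pow_notMem_pow_succ {P : Ideal B} (hP : Prime P) {x : B}
    (hx1 : x ∈ P) (hx2 : x ∉ P ^ 2) (n : ℕ) : x ^ n ∉ P ^ (n + 1) := by
  have h1 : emultiplicity P (Ideal.span {x}) = (1 : ℕ) :=
    emultiplicity_eq_coe.mpr ⟨by simpa [Ideal.dvd_span_singleton] using hx1,
      by simpa [Ideal.dvd_span_singleton] using hx2⟩
  have h2 : emultiplicity P (Ideal.span {x ^ n}) = n := by
    rw [← Ideal.span_singleton_pow, emultiplicity_pow hP, h1]
    simp
  rw [← Ideal.dvd_span_singleton]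
  exact (emultiplicity_eq_coe.mp h2).2

end Multiplicity

/-! ### Uniformizers at a totally ramified prime -/

section TotallyRamified

variable {A B : Type*} [CommRing A] [CommRing B] [IsDedekindDomain B] [Algebra A B]

/-- If the residue field at `P` does not grow, powers of a uniformizer `π` generate `B` over `A`
modulo any power of `P`. -/
theorem exists_mem_adjoin_sub_mem_pow {P : Ideal B} [P.IsPrime] (hP0 : P ≠ ⊥)
    (hsurj : ∀ b : B, ∃ a : A, b - algebraMap A B a ∈ P)
    {π : B} (hπ1 : π ∈ P) (hπ2 : π ∉ P ^ 2) (b : B) (n : ℕ) :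
    ∃ c ∈ Algebra.adjoin A {π}, b - c ∈ P ^ n := by
  have hP : Prime P := Ideal.prime_of_isPrime hP0 inferInstance
  induction n with
  | zero => exact ⟨0, zero_mem _, by simp⟩
  | succ n ih =>
    obtain ⟨c, hc, hbc⟩ := ih
    obtain ⟨d, e, he, hde⟩ := Ideal.exists_mul_add_mem_pow_succ hP0 (π ^ n) (b - c)
      (Ideal.pow_mem_pow hπ1 n) (pow_notMem_pow_succ hP hπ1 hπ2 n) hbc
    obtain ⟨a, ha⟩ := hsurj d
    -- `b - c = π ^ n * d` modulo `P ^ (n + 1)`, and there `d` may be replaced by `a ∈ A`.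
    have hπ : π ∈ Algebra.adjoin A {π} := Algebra.self_mem_adjoin_singleton A π
    refine ⟨c + π ^ n * algebraMap A B a, Subalgebra.add_mem _ hc
      (Subalgebra.mul_mem _ (Subalgebra.pow_mem _ hπ n) (Subalgebra.algebraMap_mem _ a)), ?_⟩
    have : b - (c + π ^ n * algebraMap A B a) = π ^ n * (d - algebraMap A B a) + e := by
      linear_combination -hde
    rw [this]
    exact add_mem (pow_succ P n ▸ Ideal.mul_mem_mul (Ideal.pow_mem_pow hπ1 n) ha) he

/-- At a totally ramified prime, a uniformizer `π` generates `B` over `A` up to denominators prime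
to `p`, by Nakayama's lemma. -/
theorem exists_notMem_algebraMap_mem_conductor [Module.Finite A B] {p : Ideal A} [p.IsPrime]
    {P : Ideal B} [P.IsPrime] (hP0 : P ≠ ⊥)
    (hsurj : ∀ b : B, ∃ a : A, b - algebraMap A B a ∈ P)
    {e : ℕ} (he : P ^ e ≤ p.map (algebraMap A B))
    {π : B} (hπ1 : π ∈ P) (hπ2 : π ∉ P ^ 2) :
    ∃ r : A, r ∉ p ∧ algebraMap A B r ∈ conductor A π := by
  let S : Submodule A B := Subalgebra.toSubmodule (Algebra.adjoin A {π})
  have hle : (⊤ : Submodule A (B ⧸ S)) ≤ p • ⊤ := by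
    rintro x -
    obtain ⟨b, rfl⟩ := S.mkQ_surjective x
    obtain ⟨c, hc, hbc⟩ := exists_mem_adjoin_sub_mem_pow hP0 hsurj hπ1 hπ2 b e
    have h1 : b - c ∈ p • (⊤ : Submodule A B) := by
      rw [Ideal.smul_top_eq_map]
      exact he hbc
    have h2 : S.mkQ b = S.mkQ (b - c) := by
      rw [map_sub, S.mkQ_apply c, (Submodule.Quotient.mk_eq_zero S).mpr hc, sub_zero]
    rw [h2]
    have := Submodule.mem_map_of_mem (f := S.mkQ) h1
    rw [Submodule.map_smul''] at this
    exact Submodule.smul_mono le_rfl le_top this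
  obtain ⟨r, hr1, hr⟩ := Submodule.exists_sub_one_mem_and_smul_eq_zero_of_fg_of_le_smul p _
    Module.Finite.fg_top hle
  refine ⟨r, fun hrp ↦ Ideal.IsPrime.ne_top ‹_› ((Ideal.eq_top_iff_one p).mpr ?_), ?_⟩
  · simpa using p.sub_mem hrp hr1
  · rw [mem_conductor_iff]
    intro b
    have := hr (S.mkQ b) trivial
    rw [← map_smul, Submodule.mkQ_apply, Submodule.Quotient.mk_eq_zero, Algebra.smul_def] at this
    exact this

end TotallyRamified

/-! ### The different and the differences of conjugates -/

section Derivative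

variable {A B : Type*} [CommRing A] [CommRing B] [Algebra A B]

theorem eval_derivative_charpoly (G : Type*) [Group G] [Fintype G] [DecidableEq G]
    [MulSemiringAction G B] (x : B) :
    (derivative (MulSemiringAction.charpoly G x)).eval x =
      ∏ g ∈ Finset.univ.erase (1 : G), (x - g • x) := by
  rw [MulSemiringAction.charpoly_eq, ← Finset.mul_prod_erase _ _ (Finset.mem_univ (1 : G))]
  simp [derivative_mul, eval_prod]

/-- If a nonzero element of `A` lies in the conductor of `A[π]`, then `π` generates the fraction
field of `B` over that of `A`. -/
theorem adjoin_eq_top_of_mem_conductor (F L : Type*) [Field F] [Field L] [Algebra F L]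
    [Algebra A F] [Algebra A L] [Algebra B L] [IsScalarTower A F L] [IsScalarTower A B L]
    [IsDomain A] [IsFractionRing A F] [IsIntegralClosure B A L] [FiniteDimensional F L]
    {π : B} {r : A} (hr0 : r ≠ 0) (hr : algebraMap A B r ∈ conductor A π) :
    Algebra.adjoin F {algebraMap B L π} = ⊤ := by
  have hL : Algebra.IsAlgebraic A L := IsFractionRing.comap_isAlgebraic_iff.mpr
    (inferInstance : Algebra.IsAlgebraic F L)
  rw [eq_top_iff]
  rintro x -
  obtain ⟨y, hy0, hy⟩ := (hL.isAlgebraic x).exists_integral_multiple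
  obtain ⟨b, hb⟩ := IsIntegralClosure.isIntegral_iff (A := B).mp hy
  have h2 : algebraMap B L (algebraMap A B r * b) ∈ Algebra.adjoin A {algebraMap B L π} := by
    have h := (Subalgebra.mem_map (f := IsScalarTower.toAlgHom A B L)).mpr
      ⟨_, mem_conductor_iff.mp hr b, rfl⟩
    rwa [AlgHom.map_adjoin, Set.image_singleton] at h
  have hle : Algebra.adjoin A {algebraMap B L π} ≤
      (Algebra.adjoin F {algebraMap B L π}).restrictScalars A :=
    Algebra.adjoin_le (Set.singleton_subset_iff.mpr
      ((Subalgebra.mem_restrictScalars A).mpr (Algebra.self_mem_adjoin_singleton F _)))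
  have h3 := (Subalgebra.mem_restrictScalars A).mp (hle h2)
  have hF : algebraMap A F (r * y) ≠ 0 := by
    rw [Ne, FaithfulSMul.algebraMap_eq_zero_iff]
    exact mul_ne_zero hr0 hy0
  have hx : x = (algebraMap A F (r * y))⁻¹ • algebraMap B L (algebraMap A B r * b) := by
    rw [eq_inv_smul_iff₀ hF, map_mul (algebraMap B L), hb, ← IsScalarTower.algebraMap_apply,
      algebraMap_smul, mul_smul, Algebra.smul_def]
  rw [hx]
  exact Subalgebra.smul_mem _ h3 _

/-- The minimal polynomial of a primitive element `π` is `∏ g, (X - g π)`, so its derivative at `π`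
is the product of the differences `π - g π` over `g ≠ 1`. -/
theorem conductor_mul_differentIdeal_eq_span_prod (G F L : Type*) [Group G] [Fintype G]
    [DecidableEq G] [MulSemiringAction G B] [Field F] [Field L] [MulSemiringAction G L]
    [Algebra F L] [Algebra A F] [Algebra A L] [Algebra B L]
    [IsScalarTower A F L] [IsScalarTower A B L] [IsDedekindDomain A] [IsDedekindDomain B]
    [IsFractionRing A F] [IsFractionRing B L] [IsIntegralClosure B A L] [FiniteDimensional F L]
    [Algebra.IsSeparable F L] [Module.IsTorsionFree A B]
    [Module.Finite A B] [IsGaloisGroup G A B] [IsGaloisGroup G F L]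
    (π : B) (hπ : Algebra.adjoin F {algebraMap B L π} = ⊤) :
    conductor A π * differentIdeal A B =
      Ideal.span {∏ g ∈ Finset.univ.erase (1 : G), (π - g • π)} := by
  have hint : IsIntegral A π := IsIntegralClosure.isIntegral A L π
  have hG := IsGaloisGroup.card_eq_finrank G F L
  have hdeg : (minpoly A π).natDegree = Nat.card G := by
    rw [hG, ← (Field.primitive_element_iff_minpoly_natDegree_eq F (algebraMap B L π)).mp ?_,
      minpoly.isIntegrallyClosed_eq_field_fractions F L hint,
      (minpoly.monic hint).natDegree_map]
    rw [← IntermediateField.toSubalgebra_injective.eq_iff, IntermediateField.top_toSubalgebra,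
      IntermediateField.adjoin_simple_toSubalgebra_of_isAlgebraic
        (Algebra.IsAlgebraic.isAlgebraic _), hπ]
  obtain ⟨q, hq, hqdeg, hqmonic⟩ := lifts_and_natDegree_eq_and_monic
    (Algebra.IsInvariant.charpoly_mem_lifts A B G π) (MulSemiringAction.monic_charpoly G π)
  have hqroot : aeval π q = 0 := by
    rw [← eval_map_algebraMap, hq, MulSemiringAction.eval_charpoly]
  have hmin : q = minpoly A π := by
    refine (eq_of_monic_of_dvd_of_natDegree_le (minpoly.monic hint) hqmonic
      (minpoly.isIntegrallyClosed_dvd hint hqroot) ?_)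
    rw [hqdeg, hdeg, MulSemiringAction.charpoly_eq, natDegree_finsetProd_X_sub_C_eq_card]
    simp
  rw [conductor_mul_differentIdeal A F L π hπ, ← hmin, ← eval_map_algebraMap, ← derivative_map, hq,
    eval_derivative_charpoly]

end Derivative

/-! ### Invariance of multiplicities under the decomposition group -/

section EvenMultiplicity

variable {B : Type*} [CommRing B]

open scoped Pointwise in
/-- If `G` fixes `P`, then `g` and `g⁻¹` move `x` by elements of equal multiplicity at `P`, since
`g (x - g⁻¹ x) = -(x - g x)`. -/
theorem emultiplicity_span_sub_smul_inv {G : Type*} [Group G] [MulSemiringAction G B]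
    [IsDedekindDomain B] {P : Ideal B} (hP : ∀ g : G, g • P = P) (x : B) (g : G) :
    emultiplicity P (Ideal.span {x - g⁻¹ • x}) = emultiplicity P (Ideal.span {x - g • x}) := by
  refine emultiplicity_span_singleton_eq_of_forall_mem_iff fun n ↦ ?_
  have h1 : x - g • x = -(g • (x - g⁻¹ • x)) := by simp [smul_sub]
  have h2 : g • P ^ n = P ^ n := by rw [smul_pow', hP]
  rw [h1, neg_mem_iff]
  nth_rewrite 2 [← h2]
  rw [Ideal.smul_mem_pointwise_smul_iff]

end EvenMultiplicity

/-! ### Even exponent of the different at a totally ramified prime -/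

section TotallyRamifiedEven

variable {A B : Type*} [CommRing A] [CommRing B] [Algebra A B]

open scoped Pointwise in
/-- Let `G`, of odd order, be the Galois group of `B / A` and fix the prime `P`, and let `P` be the
only prime over `P ∩ A`, in the form that a power of `P` lies in `(P ∩ A) B`, with trivial residue
field extension. Then `P` has even exponent in the
different: that exponent is a sum over `g ≠ 1` of multiplicities that agree at `g` and `g⁻¹`. -/
theorem even_multiplicity_differentIdeal_of_totallyRamified (G F L : Type*) [Group G] [Finite G]
    [MulSemiringAction G B] [Field F] [Field L] [MulSemiringAction G L]
    [Algebra F L] [Algebra A F] [Algebra A L] [Algebra B L]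
    [IsScalarTower A F L] [IsScalarTower A B L] [IsDedekindDomain A] [IsDedekindDomain B]
    [IsFractionRing A F] [IsFractionRing B L] [IsIntegralClosure B A L] [FiniteDimensional F L]
    [Algebra.IsSeparable F L] [Module.IsTorsionFree A B]
    [Module.Finite A B] [IsGaloisGroup G A B] [IsGaloisGroup G F L]
    (hG : Odd (Nat.card G)) (P : Ideal B) [P.IsPrime] (hP0 : P ≠ ⊥) (hfix : ∀ g : G, g • P = P)
    (hsurj : ∀ b : B, ∃ a : A, b - algebraMap A B a ∈ P)
    {e : ℕ} (he : P ^ e ≤ (P.under A).map (algebraMap A B)) :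
    Even (multiplicity P (differentIdeal A B)) := by
  classical
  have := Fintype.ofFinite G
  have hP : Prime P := Ideal.prime_of_isPrime hP0 inferInstance
  obtain ⟨π, hπ1, hπ2⟩ := Ideal.exists_mem_pow_notMem_pow_succ P hP0 Ideal.IsPrime.ne_top' 1
  rw [pow_one] at hπ1
  obtain ⟨r, hrp, hr⟩ := exists_notMem_algebraMap_mem_conductor
    (p := P.under A) hP0 hsurj he hπ1 hπ2
  have hr0 : r ≠ 0 := fun h ↦ hrp (h ▸ zero_mem _)
  have hspan := conductor_mul_differentIdeal_eq_span_prod (A := A) G F L π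
    (adjoin_eq_top_of_mem_conductor F L hr0 hr)
  have hcond : ¬ P ∣ conductor A π := fun h ↦ hrp (Ideal.le_of_dvd h hr)
  have hD0 : differentIdeal A B ≠ ⊥ := by
    rw [ne_eq, ← FractionalIdeal.coeIdeal_inj (K := L), coeIdeal_differentIdeal (K := F)]
    simp
  have hC0 : conductor A π ≠ ⊥ := fun h ↦ hcond (h ▸ dvd_zero P)
  have h0 : conductor A π * differentIdeal A B ≠ 0 := mul_ne_zero hC0 hD0
  have hne : ∀ g ∈ Finset.univ.erase (1 : G), Ideal.span {π - g • π} ≠ 0 := by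
    rw [hspan, ← Ideal.prod_span_singleton, Finset.prod_ne_zero_iff] at h0
    exact h0
  have hmul : multiplicity P (differentIdeal A B) =
      ∑ g ∈ Finset.univ.erase (1 : G), multiplicity P (Ideal.span {π - g • π}) := by
    have h1 := multiplicity_mul hP (FiniteMultiplicity.of_prime_left hP h0)
    rw [multiplicity_eq_zero.mpr hcond, zero_add, hspan, ← Ideal.prod_span_singleton] at h1
    rw [← h1]
    apply Nat.cast_injective (R := ℕ∞)
    rw [← (FiniteMultiplicity.of_prime_left hP
        (Finset.prod_ne_zero_iff.mpr hne)).emultiplicity_eq_multiplicity,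
      Finset.emultiplicity_prod hP, Nat.cast_sum]
    exact Finset.sum_congr rfl fun g hg ↦
      (FiniteMultiplicity.of_prime_left hP (hne g hg)).emultiplicity_eq_multiplicity
  rw [hmul]
  exact even_sum_erase_one_of_inv_invariant hG _ fun g ↦
    multiplicity_eq_of_emultiplicity_eq (emultiplicity_span_sub_smul_inv hfix π g)

end TotallyRamifiedEven

/-! ### Reduction to the inertia field -/

section InertiaField

theorem exists_pow_le_of_forall_isPrime_eq {B : Type*} [CommRing B] [IsNoetherianRing B]
    {I P : Ideal B} (h : ∀ Q : Ideal B, Q.IsPrime → I ≤ Q → Q = P) : ∃ e, P ^ e ≤ I := by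
  obtain ⟨e, he⟩ := Ideal.exists_radical_pow_le_of_fg I (IsNoetherian.noetherian _)
  refine ⟨e, (Ideal.pow_right_mono ?_ e).trans he⟩
  rw [Ideal.radical_eq_sInf]
  exact le_sInf fun Q hQ ↦ (h Q hQ.2 hQ.1).ge

variable {K : Type*} [Field K] [NumberField K] [IsGalois ℚ K]

open scoped Pointwise in
/-- In a Galois number field of odd degree, every prime has even exponent in the different. -/
theorem even_multiplicity_differentIdeal (hodd : Odd (Module.finrank ℚ K))
    (P : Ideal (𝓞 K)) [hPp : P.IsPrime] (hP0 : P ≠ ⊥) :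
    Even (multiplicity P (differentIdeal ℤ (𝓞 K))) := by
  have hP : Prime P := Ideal.prime_of_isPrime hP0 inferInstance
  let I : Subgroup Gal(K/ℚ) := P.inertia Gal(K/ℚ)
  let E : IntermediateField ℚ K := FixedPoints.intermediateField I
  have hE : IsGaloisGroup I E K := IsGaloisGroup.subgroup Gal(K/ℚ) ℚ K I
  have hEO : IsGaloisGroup I (𝓞 E) (𝓞 K) := IsGaloisGroup.of_isFractionRing I (𝓞 E) (𝓞 K) E K
  let p : Ideal (𝓞 E) := P.under (𝓞 E)
  have hp0 : p ≠ ⊥ := Ideal.IsIntegral.comap_ne_bot _ hP0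
  have hPm : P.IsMaximal := hPp.isMaximal hP0
  have hpm : p.IsMaximal := Ideal.IsMaximal.under (𝓞 E) P
  have hfin : Finite (𝓞 E ⧸ p) := Ring.HasFiniteQuotients.finiteQuotient hp0
  have hcard : Nat.card (P.inertia I) = Nat.card I := by
    rw [show P.inertia I = ⊤ from eq_top_iff.mpr fun g _ ↦ g.2, Subgroup.card_top]
  -- All of `I` is inertia at `P`, so counting over `𝓞 E` leaves one prime of residue degree one.
  have hone : (p.primesOver (𝓞 K)).ncard = 1 ∧ P.inertiaDeg (𝓞 E) = 1 := by
    have hef := Ideal.ncard_primesOver_mul_card_inertia_mul_finrank (G := I) p P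
    rw [hcard, mul_right_comm] at hef
    exact mul_eq_one.mp (Nat.eq_of_mul_eq_mul_right Nat.card_pos (hef.trans (one_mul _).symm))
  have hsurj : ∀ b : 𝓞 K, ∃ a : 𝓞 E, b - algebraMap (𝓞 E) (𝓞 K) a ∈ P := by
    intro b
    have h1 := hone.2
    rw [Ideal.inertiaDeg_eq_of_isMaximal p P] at h1
    let := Ideal.Quotient.field p
    obtain ⟨a, ha⟩ := (Algebra.finrank_eq_one_iff_bijective_algebraMap.mp h1).2
      (Ideal.Quotient.mk P b)
    obtain ⟨a, rfl⟩ := Ideal.Quotient.mk_surjective a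
    exact ⟨a, Ideal.Quotient.eq.mp ha.symm⟩
  obtain ⟨e, he⟩ : ∃ e, P ^ e ≤ p.map (algebraMap (𝓞 E) (𝓞 K)) := by
    refine exists_pow_le_of_forall_isPrime_eq fun Q hQ hle ↦ ?_
    have hlies : Q.LiesOver p := ⟨hpm.eq_of_le (hQ.under (𝓞 E)).ne_top
      (Ideal.map_le_iff_le_comap.mp hle)⟩
    obtain ⟨R, hR⟩ := Set.ncard_eq_one.mp hone.1
    have h1 : Q ∈ p.primesOver (𝓞 K) := ⟨hQ, hlies⟩
    have h2 : P ∈ p.primesOver (𝓞 K) := ⟨hPp, inferInstance⟩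
    rw [hR, Set.mem_singleton_iff] at h1 h2
    rw [h1, h2]
  -- The inertia group has order `e(P | ℤ)` and also `e(P | 𝓞 E)`, so `e(p | ℤ) = 1`.
  have hunram : ¬ p ∣ differentIdeal ℤ (𝓞 E) := by
    rw [not_dvd_differentIdeal_iff, ← Ideal.ramificationIdx_eq_one_iff]
    have hq0 : P.under ℤ ≠ ⊥ := Ideal.IsIntegral.comap_ne_bot _ hP0
    have hqm : (P.under ℤ).IsMaximal := Ideal.IsMaximal.under ℤ P
    have hqfin : Finite (ℤ ⧸ P.under ℤ) := Ring.HasFiniteQuotients.finiteQuotient hq0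
    have h1 := Ideal.card_inertia_eq_ramificationIdxIn (G := I) p P
    have h2 := Ideal.card_inertia_eq_ramificationIdxIn (G := Gal(K/ℚ)) (P.under ℤ) P
    rw [Ideal.ramificationIdxIn_eq_ramificationIdx p P I, hcard] at h1
    rw [Ideal.ramificationIdxIn_eq_ramificationIdx (P.under ℤ) P Gal(K/ℚ),
      Ideal.ramificationIdx_tower (R := ℤ) p P, ← h1] at h2
    exact (Nat.eq_of_mul_eq_mul_right (Nat.card_pos (α := I)) ((one_mul _).trans h2)).symm
  have hnot : ¬ P ∣ (differentIdeal ℤ (𝓞 E)).map (algebraMap (𝓞 E) (𝓞 K)) := fun h ↦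
    hunram (Ideal.dvd_iff_le.mpr (Ideal.map_le_iff_le_comap.mp (Ideal.le_of_dvd h)))
  have hoddI : Odd (Nat.card I) := by
    rw [← IsGalois.card_aut_eq_finrank] at hodd
    exact hodd.of_dvd_nat (Subgroup.card_subgroup_dvd_card I)
  have hev := even_multiplicity_differentIdeal_of_totallyRamified I E K hoddI P hP0
    (fun g ↦ Ideal.inertia_le_stabilizer P g.2) hsurj he
  rw [differentIdeal_eq_differentIdeal_mul_differentIdeal ℤ (𝓞 E) (𝓞 K), multiplicity_mul hP
    (FiniteMultiplicity.of_prime_left hP (mul_ne_zero differentIdeal_ne_bot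
      (fun h ↦ hnot (by rw [h]; exact dvd_zero P)))), multiplicity_eq_zero.mpr hnot, add_zero]
  exact hev

end InertiaField

/-! ### Number fields of odd degree -/

section Conjugation

variable {K : Type*} [Field K] [NumberField K]

/-- A CM field is quadratic over its maximal real subfield, so its degree is even. -/
theorem not_isCMField_of_odd_finrank (hodd : Odd (Module.finrank ℚ K)) : ¬ IsCMField K := by
  intro h
  rw [← Module.finrank_mul_finrank ℚ (maximalRealSubfield K) K,
    Algebra.IsQuadraticExtension.finrank_eq_two (maximalRealSubfield K) K] at hodd
  exact Nat.not_even_iff_odd.mpr hodd (even_two.mul_left _)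

theorem conj_apply_of_odd_finrank (hodd : Odd (Module.finrank ℚ K)) (x : K) : conj K x = x := by
  rw [conj, dif_neg (not_isCMField_of_odd_finrank hodd)]
  rfl

/-- Taking norms turns a square root of `ℓ` in a field of odd degree into a rational one. -/
theorem isSquare_of_natCast_eq_mul_self (hodd : Odd (Module.finrank ℚ K)) {ℓ : ℕ} (hℓ : ℓ ≠ 0)
    {β : K} (h : (ℓ : K) = β * β) : IsSquare ℓ := by
  rw [← Rat.isSquare_natCast_iff]
  obtain ⟨k, hk⟩ := hodd
  have h1 := congrArg (Algebra.norm ℚ) h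
  rw [map_mul, ← map_natCast (algebraMap ℚ K), Algebra.norm_algebraMap, hk, pow_succ, pow_mul,
    pow_two] at h1
  have hℓ' : (ℓ : ℚ) ≠ 0 := by exact_mod_cast hℓ
  -- Here `N(β)² = ℓ ^ (2 * k + 1)`.
  refine ⟨Algebra.norm ℚ β / (ℓ : ℚ) ^ k, ?_⟩
  field_simp
  rw [pow_two, pow_two, ← h1, mul_pow]
  ring

/-- In a totally real field the trace of a nonzero square is a sum of squares of nonzero reals. -/
theorem trace_mul_self_pos [IsTotallyReal K] {x : K} (hx : x ≠ 0) :
    0 < Algebra.trace ℚ K (x * x) := by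
  have h := trace_eq_sum_embeddings ℂ (K := ℚ) (x := x * x)
  have h2 := congrArg Complex.re h
  rw [Complex.re_sum] at h2
  have h3 : (algebraMap ℚ ℂ (Algebra.trace ℚ K (x * x))).re =
      ((Algebra.trace ℚ K (x * x) : ℚ) : ℝ) := by simp
  rw [h3] at h2
  rw [← Rat.cast_pos (K := ℝ), h2]
  refine Finset.sum_pos (fun σ _ ↦ ?_) ⟨(IsAlgClosed.lift : K →ₐ[ℚ] ℂ), Finset.mem_univ _⟩
  have him : (σ x).im = 0 := by
    have hr : ComplexEmbedding.IsReal (σ : K →+* ℂ) := by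
      have := IsTotallyReal.isReal (InfinitePlace.mk (σ : K →+* ℂ))
      rwa [InfinitePlace.isReal_mk_iff] at this
    exact Complex.conj_eq_iff_im.mp (RingHom.congr_fun hr x)
  have hre : (σ x).re ≠ 0 := fun h0 ↦ hx ((map_eq_zero σ).mp (Complex.ext h0 him))
  rw [map_mul, Complex.mul_re, him]
  simpa using mul_self_pos.mpr hre

end Conjugation

/-! ### Square roots of fractional ideals -/

section SquareRoot

variable {R K : Type*} [CommRing R] [IsDedekindDomain R] [Field K] [Algebra R K]
  [IsFractionRing R K]

open FractionalIdeal

theorem fractionalIdeal_eq_of_count_eq {I J : FractionalIdeal R⁰ K} (hI : I ≠ 0) (hJ : J ≠ 0)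
    (h : ∀ v, count K v I = count K v J) : I = J := by
  rw [← finprod_heightOneSpectrum_factorization' K hI,
    ← finprod_heightOneSpectrum_factorization' K hJ]
  simp only [h]

theorem fractionalIdeal_eq_of_sq_eq_sq {I J : FractionalIdeal R⁰ K} (hI : I ≠ 0) (hJ : J ≠ 0)
    (h : I ^ 2 = J ^ 2) : I = J := by
  refine fractionalIdeal_eq_of_count_eq hI hJ fun v ↦ ?_
  have := congrArg (count K v) h
  rw [count_pow, count_pow] at this
  exact mul_left_cancel₀ (by simp) this

theorem exists_sq_eq_of_forall_even_count {I : FractionalIdeal R⁰ K} (hI : I ≠ 0)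
    (h : ∀ v, Even (count K v I)) : ∃ J : FractionalIdeal R⁰ K, J ^ 2 = I := by
  classical
  have hfin : {v | count K v I ≠ 0}.Finite :=
    Filter.eventually_cofinite.mp (FractionalIdeal.finite_factors I)
  let f : IsDedekindDomain.HeightOneSpectrum R →₀ ℤ :=
    Finsupp.ofSupportFinite (fun v ↦ count K v I / 2)
      (hfin.subset fun v hv h0 ↦ hv (by simp [h0]))
  have hJ : f.prod (fun v n ↦ (v.asIdeal : FractionalIdeal R⁰ K) ^ n) ≠ 0 :=
    Finset.prod_ne_zero_iff.mpr fun v _ ↦ zpow_ne_zero _ (coeIdeal_ne_zero.mpr v.ne_bot)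
  refine ⟨f.prod fun v n ↦ (v.asIdeal : FractionalIdeal R⁰ K) ^ n,
    fractionalIdeal_eq_of_count_eq (pow_ne_zero 2 hJ) hI fun v ↦ ?_⟩
  rw [count_pow, count_finsuppProd]
  exact Int.mul_ediv_cancel' (h v).two_dvd

end SquareRoot

/-! ### The lattice on the inverse square root of the different -/

section Different

variable (K : Type*) [Field K] [NumberField K]

theorem different_ne_zero : different K ≠ 0 := by
  rw [different, FractionalIdeal.coeIdeal_ne_zero]
  exact differentIdeal_ne_bot

theorem even_count_different [IsGalois ℚ K] (hodd : Odd (Module.finrank ℚ K))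
    (P : IsDedekindDomain.HeightOneSpectrum (𝓞 K)) :
    Even (FractionalIdeal.count K P (different K)) := by
  classical
  have := even_multiplicity_differentIdeal hodd P.asIdeal P.ne_bot
  have hD : differentIdeal ℤ (𝓞 K) ≠ ⊥ := differentIdeal_ne_bot
  rw [different, FractionalIdeal.count_coe K P hD,
    Ideal.count_associates_factors_eq hD P.isPrime P.ne_bot,
    IsDedekindDomain.HeightOneSpectrum.count_normalizedFactors_eq_multiplicity hD]
  exact_mod_cast this

variable {K}

/-- For `α = 1` and trivial conjugation, the dual lattice is the trace dual `𝒟⁻¹ I⁻¹`. -/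
theorem dualLattice_one (hconj : ∀ x : K, conj K x = x) {I : FractionalIdeal (𝓞 K)⁰ K}
    (hI : I ≠ 0) : dualLattice I 1 = lattice ((different K)⁻¹ * I⁻¹) := by
  rw [different, coeIdeal_differentIdeal ℤ ℚ K, inv_inv, ← FractionalIdeal.dual_eq_mul_inv]
  ext x
  rw [mem_dualLattice]
  refine Iff.trans (forall₂_congr fun y _ ↦ ?_) (FractionalIdeal.mem_dual (A := ℤ) (K := ℚ) hI).symm
  rw [one_mul, hconj, Algebra.traceForm_apply]
  rfl

/-- An inverse square root `J` of the different is self-dual: `𝒟⁻¹ J⁻¹ = J² J⁻¹ = J`. -/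
theorem dualLattice_one_eq_of_sq_eq (hconj : ∀ x : K, conj K x = x)
    {J : FractionalIdeal (𝓞 K)⁰ K} (hJ : J ≠ 0) (hJ2 : J ^ 2 = (different K)⁻¹) :
    dualLattice J 1 = lattice J := by
  rw [dualLattice_one hconj hJ, ← hJ2, pow_two, mul_assoc, mul_inv_cancel₀ hJ, mul_one]

theorem isIdealLattice_one [IsTotallyReal K] (hconj : ∀ x : K, conj K x = x)
    {J : FractionalIdeal (𝓞 K)⁰ K} (hJ : J ≠ 0) : IsIdealLattice J (1 : K) where
  ne_zero := hJ
  totallyPositive σ := by simp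
  symm x _ y _ := by rw [form_apply, form_apply, hconj, hconj, mul_assoc, mul_comm x, mul_assoc]
  posDef x _ hx := by
    rw [form_apply, one_mul, hconj]
    exact trace_mul_self_pos hx

theorem isUnimodular_one [IsTotallyReal K] (hconj : ∀ x : K, conj K x = x)
    {J : FractionalIdeal (𝓞 K)⁰ K} (hJ : J ≠ 0) (hJ2 : J ^ 2 = (different K)⁻¹) :
    IsUnimodular J (1 : K) := by
  have hdual := dualLattice_one_eq_of_sq_eq hconj hJ hJ2
  exact ⟨isIdealLattice_one hconj hJ, fun x hx y hy ↦
    (mem_dualLattice J 1 x).mp (hdual.ge hx) y hy, hdual.symm⟩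

theorem IsUnimodular.isArakelovModular_one {I : FractionalIdeal (𝓞 K)⁰ K} {α : K}
    (h : IsUnimodular I α) : IsArakelovModular I α 1 := by
  refine ⟨h.1, 1, one_ne_zero, ?_, by simp⟩
  rw [← h.2.2, LinearMap.mulLeft_one, Submodule.map_id]

end Different

end ArakelovLattice

theorem mainTheorem2 (K : Type*) [Field K] [NumberField K] [IsGalois ℚ K]
    (hodd : Odd (Module.finrank ℚ K)) (hK : IsTotallyReal K ∨ IsCMField K) :
    ArakelovLattice.Mod K = {1} ∧
    (∀ P : IsDedekindDomain.HeightOneSpectrum (𝓞 K),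
      Even (FractionalIdeal.count K P (ArakelovLattice.different K))) ∧
    (∃ J : FractionalIdeal (𝓞 K)⁰ K,
      J ^ 2 = (ArakelovLattice.different K)⁻¹ ∧
      (∀ J' : FractionalIdeal (𝓞 K)⁰ K, J' ^ 2 = (ArakelovLattice.different K)⁻¹ → J' = J) ∧
      ArakelovLattice.IsArakelovModular J 1 1 ∧
      ArakelovLattice.IsUnimodular J 1) := by
  open ArakelovLattice in
  have hreal : IsTotallyReal K := hK.resolve_right (not_isCMField_of_odd_finrank hodd)
  have hconj := conj_apply_of_odd_finrank hodd
  have heven := even_count_different K hodd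
  have hD : (different K)⁻¹ ≠ 0 := inv_ne_zero (different_ne_zero K)
  have hne : ∀ J : FractionalIdeal (𝓞 K)⁰ K, J ^ 2 = (different K)⁻¹ → J ≠ 0 := by
    rintro J hJ rfl
    exact hD (hJ.symm.trans (zero_pow two_ne_zero))
  obtain ⟨J, hJ⟩ := exists_sq_eq_of_forall_even_count hD fun v ↦ by
    rw [FractionalIdeal.count_inv]
    exact (heven v).neg
  have huni := isUnimodular_one hconj (hne J hJ) hJ
  refine ⟨?_, heven, J, hJ, fun J' hJ' ↦ fractionalIdeal_eq_of_sq_eq_sq (hne J' hJ') (hne J hJ)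
    (hJ'.trans hJ.symm), huni.isArakelovModular_one, huni⟩
  ext ℓ
  rw [Set.mem_singleton_iff]
  constructor
  · rintro ⟨hpos, hsf, I, α, -, β, -, -, hβ⟩
    rw [hconj] at hβ
    obtain ⟨a, rfl⟩ := isSquare_of_natCast_eq_mul_self hodd hpos.ne' hβ
    rw [Nat.isUnit_iff.mp (hsf a dvd_rfl)]
  · rintro rfl
    exact ⟨one_pos, squarefree_one, J, 1, huni.isArakelovModular_one⟩
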